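/- Let $\mathrm{tw}_1(x)=x$ and $\mathrm{tw}_{i+1}(x)=2^{\mathrm{tw}_i(x)}$; let $[N]=\{1,\dots,N\}$ and let $\binom{S}{k}$ be the set of $k$-element subsets of $S$. The shift graph $Sh(N,l)$ has vertex set $\binom{[N]}{l}$, and its edges are the pairs $\{x_1,\dots,x_l\},\{x_2,\dots,x_{l+1}\}$ with $x_1<\dots<x_{l+1}$. For a map $f$ from a finite nonempty set $A$ to a set of $c$ colors, the relative discrepancy is $disc(f,A)=\max_i\left|\frac{|\{x\in A : f(x)=i\}|}{|A|}-\frac1c\right|$. For an integer $l\ge 5$ define a color $\chi_l(X)\in\{0,1,2\}$ of an $l$-element set $X$ of positive integers recursively, writing $X^-$ for $X$ without its largest element and $X^+$ for $X$ without its smallest element. (i) $\beta_1(\{x\})=x-1$, and for $|X|=h+1$, $\beta_{h+1}(X)=2i+a_i$, where $a=\beta_h(X^-)$, $b=\beta_h(X^+)$, $i$ is the lowest binary position at which $a$ and $b$ differ, and $a_i$ is the $i$-th binary digit of $a$. (ii) With the colors $0,\dots,19$ identified with the $3$-subsets of $\{0,\dots,5\}$ (ordered by binary code), for $|X|=l-3$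 let $\beta'(X)$ be the least element of $\beta_{l-4}(X^-)\setminus\beta_{l-4}(X^+)$; with the colors $0,\dots,5$ identified in the same way with the $2$-subsets of $\{0,1,2,3\}$, for $|X|=l-2$ let $\beta''(X)$ be the least element of $\beta'(X^-)\setminus\beta'(X^+)$. (iii) For $|X|=l$ let $a,b,c'$ be the colors $\beta''$ of the first, the middle and the last $l-2$ consecutive elements of $X$; then $\chi_l(X)=b$ if $b\ne 3$, and $\chi_l(X)=\min(\{0,1,2\}\setminus\{a,c'\})$ if $b=3$. (Where a step is not defined, because the two colors coincide or are out of range, any fixed default value is used; this does not occur for subsets of $[N]$ when $N\le 4\,\mathrm{tw}_{l-3}(2)$.) **Theorem.** For every odd $c\ge 3$ there exists $l_0\ge 5$ such that for every $\delta\in(0,1)$ there exists $\varepsilon>0$ such that the following holds for all $l\ge l_0$, all $k$ divisible by $l$ and all $N$ with $$k\ge l^{7+3\delta}\quad\text{and}\quad N\le 4\,\mathrm{tw}_{l-3}(2).$$ The map $\chi_l$ is a proper $3$-coloring of $Sh(N,l)$, and the $c$-coloring $\gamma'$ of $\binom{[N]}{k}$ given explicitly by $$\gamma'(X)=\sum_{i=1}^{k/l}\chi_l(X_i)\bmod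 c,$$ where $X_1,\dots,X_{k/l}$ is the partition of $X$ into consecutive blocks of $l$ elements, satisfies $$disc\left(\gamma',\tbinom{S}{k}\right)\le \exp(-\varepsilon l^{\delta})$$ for every $S\subseteq[N]$ with $|S|\ge k(1+1/l)$. -/

import Mathlib

namespace ShiftDisc

/-- The tower function: `tw 1 x = x`, `tw (i + 1) x = 2 ^ tw i x` for `i ≥ 1`
(the index `0` is not used; it is given the value `x`). -/
def tw : ℕ → ℕ → ℕ
  | 0, x => x
  | 1, x => x
  | i + 2, x => 2 ^ tw (i + 1) x

/-- The relative discrepancy of the colouring `f` with colour set `C` on the finite set `A`: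
the maximum over the colours `i` of `|Prob [f x = i] - 1 / |C||`, `x` uniform in `A`. -/
noncomputable def disc {α C : Type*} [Fintype C] [DecidableEq C] (f : α → C) (A : Finset α) : ℝ :=
  ⨆ i : C, |((A.filter (fun x => f x = i)).card : ℝ) / (A.card : ℝ) - 1 / (Fintype.card C : ℝ)|

/-- `X` without its largest element. -/
def dropMax (X : Finset ℕ) : Finset ℕ := X.filter (fun x => ∃ y ∈ X, x < y)

/-- `X` without its smallest element. -/
def dropMin (X : Finset ℕ) : Finset ℕ := X.filter (fun x => ∃ y ∈ X, y < x)

/-- `A` and `B` are in shift position, as `l`-sets: for some `x₁ < ⋯ < x_{l+1}`,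
`A = {x₁, …, x_l}` and `B = {x₂, …, x_{l+1}}`. -/
def ShiftPosition (l : ℕ) (A B : Finset ℕ) : Prop :=
  ∃ D : Finset ℕ, D.card = l + 1 ∧ A = dropMax D ∧ B = dropMin D

/-- The shift graph on the `l`-element subsets of `[N] = {1, …, N}`. -/
def shiftGraph (N l : ℕ) : SimpleGraph {X : Finset ℕ // X ∈ (Finset.Icc 1 N).powersetCard l} :=
  SimpleGraph.fromRel (fun A B => ShiftPosition l A.1 B.1)

/-! ### The explicit 3-colouring of the shift graph -/

theorem exists_testBit_ne {a b : ℕ} (h : a ≠ b) : ∃ i, a.testBit i ≠ b.testBit i := by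
  by_contra hc
  push Not at hc
  exact h (Nat.eq_of_testBit_eq hc)

/-- For `a ≠ b`, the pair of the first binary position `i` at which `a` and `b` differ
and of the digit of `a` there, encoded as `2 * i + digit`. It lies below `2 * s` if `a, b < 2 ^ s`. -/
def bitStep (a b : ℕ) : ℕ :=
  if h : a = b then 0
  else 2 * Nat.find (exists_testBit_ne h) + (a.testBit (Nat.find (exists_testBit_ne h))).toNat

/-- The colour of a `(j + 1)`-set `X`: the element itself (counted from `0`) if `j = 0`, and
the bit step applied to the colours of the two `j`-subsets of consecutive elements of `X` otherwise. -/
def bitColor : ℕ → Finset ℕ → ℕ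
  | 0, X => X.sup id - 1
  | j + 1, X => bitStep (bitColor j (dropMax X)) (bitColor j (dropMin X))

/-- The `a`-th `s`-element subset of `{0, …, 2 * s - 1}`
(the subsets being ordered by their binary codes). -/
def middleLayer (s a : ℕ) : Finset ℕ :=
  (((List.range (2 ^ (2 * s))).map
      (fun b => (Finset.range (2 * s)).filter (fun i => b.testBit i = true))).filter
    (fun A => A.card = s)).getD a ∅

/-- With the colours `a, b` read as `s`-element subsets of `{0, …, 2 * s - 1}`:
the first element of the first set that is not in the second one. -/
def spernerStep (s a b : ℕ) : ℕ := (middleLayer s a \ middleLayer s b).min.untopD 0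

/-- The colour, in `{0, …, 5}`, of a `(j + 2)`-set. -/
def sixColor (j : ℕ) (X : Finset ℕ) : ℕ :=
  spernerStep 3 (bitColor j (dropMax X)) (bitColor j (dropMin X))

/-- The colour, in `{0, …, 3}`, of a `(j + 3)`-set. -/
def fourColor (j : ℕ) (X : Finset ℕ) : ℕ :=
  spernerStep 2 (sixColor j (dropMax X)) (sixColor j (dropMin X))

/-- The 3-colouring of the paths `(a, b), (b, c)` of the complete digraph on `{0, 1, 2, 3}`:
`b` if `b ≠ 3`, and the first element of `{0, 1, 2} \ {a, c}` if `b = 3`. -/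
def threeStep (a b c : ℕ) : ℕ :=
  if b ≠ 3 then b else (Finset.range 3 \ {a, c}).min.untopD 0

/-- The explicit colour, in `{0, 1, 2}`, of an `l`-set `X`, for `l ≥ 5`. -/
def shiftColor (l : ℕ) (X : Finset ℕ) : ℕ :=
  threeStep (fourColor (l - 5) (dropMax (dropMax X)))
    (fourColor (l - 5) (dropMin (dropMax X)))
    (fourColor (l - 5) (dropMin (dropMin X)))

/-! ### The explicit colouring of the `k`-sets -/

/-- The `i`-th block (counted from `0`) of `l` consecutive elements of `X`: the elements
`x_{il+1}, …, x_{il+l}` of `X = {x₁ < x₂ < ⋯}`. -/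
def block (l : ℕ) (X : Finset ℕ) (i : ℕ) : Finset ℕ :=
  X.filter (fun x => (X.filter (fun y => y < x)).card / l = i)

/-- The colour of a `k`-set `X`, for `l ∣ k`: the sum modulo `c` of the shift graph colours of its
`k / l` consecutive `l`-blocks. -/
def blockSumColor (c k l : ℕ) (X : Finset ℕ) : ZMod c :=
  ∑ i ∈ Finset.range (k / l), (shiftColor l (block l X i) : ZMod c)

end ShiftDisc

namespace ShiftDisc

/-! Properness: each recursive step turns a colouring in which consecutive sets differ into one with
the same property and fewer colours. Bit steps bring the tower-sized range down to 16, which fits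
into the 20 triples in a 6-set; two Sperner steps give 6 and then 4 colours, and `threeStep` gives
3.

Discrepancy: by Fourier inversion on `ZMod c` it suffices to bound, for each `t ≠ 0`, the average
over the `k`-sets of the product of `φ (X_i)`, where `φ B = ψ (t * χ_l B)` and `ψ` is the standard
character. Averaging over subsets reduces `S` to sets `Z` of exactly `m * (l + 1)` elements, `m = k
/ l`. There the uniform `k`-set is replaced by an independent random subset with density `p = l / (l
+ 1)`, restricted to size `k`. As `k` is the most likely size, this costs only a factor `m * (l + 1)
+ 1`.

The random subset is produced by scanning `Z` in increasing order. When a block starts, look at the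
next `l + 1` entries `x, D, y`. Dropping only `x` and dropping only `y` have the same probability
`(1 - p) * p ^ l`, of order `1 / l`, and leave the same state. The completed blocks are adjacent in
the shift graph, so for odd `c` their `φ`-values differ and their sum has norm at most `2 - η`. Thus
(`norm_blockWeight_le`) every block after the first gains a factor `1 - g` with `g` of order `η /
l`. Since `m ≥ l ^ (6 + 3δ)`, the product of these factors beats the polynomial loss. -/

/-! ### Deleting the extreme elements -/

theorem mem_dropMax {X : Finset ℕ} {x : ℕ} : x ∈ dropMax X ↔ x ∈ X ∧ ∃ y ∈ X, x < y := by
  simp [dropMax]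

theorem mem_dropMin {X : Finset ℕ} {x : ℕ} : x ∈ dropMin X ↔ x ∈ X ∧ ∃ y ∈ X, y < x := by
  simp [dropMin]

theorem dropMax_subset (X : Finset ℕ) : dropMax X ⊆ X := Finset.filter_subset _ _

theorem dropMin_subset (X : Finset ℕ) : dropMin X ⊆ X := Finset.filter_subset _ _

/-- This identifies the middle term shared by two consecutive colour pairs. -/
theorem dropMax_dropMin (X : Finset ℕ) : dropMax (dropMin X) = dropMin (dropMax X) := by
  ext x
  simp only [mem_dropMax, mem_dropMin]
  constructor
  · rintro ⟨⟨hx, y, hy, hyx⟩, z, ⟨hz, -⟩, hxz⟩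
    exact ⟨⟨hx, z, hz, hxz⟩, y, ⟨hy, x, hx, hyx⟩, hyx⟩
  · rintro ⟨⟨hx, y, hy, hyx⟩, z, ⟨hz, -⟩, hxz⟩
    exact ⟨⟨hx, z, hz, hxz⟩, y, ⟨hy, x, hx, hyx⟩, hyx⟩

theorem dropMax_eq_erase {X : Finset ℕ} (h : X.Nonempty) : dropMax X = X.erase (X.max' h) := by
  ext x
  rw [mem_dropMax, Finset.mem_erase]
  constructor
  · rintro ⟨hx, y, hy, hxy⟩
    exact ⟨(hxy.trans_le (X.le_max' y hy)).ne, hx⟩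
  · rintro ⟨hne, hx⟩
    exact ⟨hx, X.max' h, X.max'_mem h, lt_of_le_of_ne (X.le_max' x hx) hne⟩

theorem dropMin_eq_erase {X : Finset ℕ} (h : X.Nonempty) : dropMin X = X.erase (X.min' h) := by
  ext x
  rw [mem_dropMin, Finset.mem_erase]
  constructor
  · rintro ⟨hx, y, hy, hxy⟩
    exact ⟨((X.min'_le y hy).trans_lt hxy).ne', hx⟩
  · rintro ⟨hne, hx⟩
    exact ⟨hx, X.min' h, X.min'_mem h, lt_of_le_of_ne (X.min'_le x hx) hne.symm⟩

theorem card_dropMax {X : Finset ℕ} {h : ℕ} (hX : X.card = h + 1) : (dropMax X).card = h := by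
  have hne : X.Nonempty := Finset.card_pos.1 (by omega)
  rw [dropMax_eq_erase hne, Finset.card_erase_of_mem (X.max'_mem hne), hX, Nat.add_sub_cancel]

theorem card_dropMin {X : Finset ℕ} {h : ℕ} (hX : X.card = h + 1) : (dropMin X).card = h := by
  have hne : X.Nonempty := Finset.card_pos.1 (by omega)
  rw [dropMin_eq_erase hne, Finset.card_erase_of_mem (X.min'_mem hne), hX, Nat.add_sub_cancel]

theorem dropMax_union_dropMin {X : Finset ℕ} (hX : 2 ≤ X.card) : dropMax X ∪ dropMin X = X := by
  refine Finset.Subset.antisymm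
    (Finset.union_subset (dropMax_subset X) (dropMin_subset X)) fun x hx => ?_
  obtain ⟨y, hy, hne⟩ := Finset.exists_mem_ne (by omega : 1 < X.card) x
  rw [Finset.mem_union, mem_dropMax, mem_dropMin]
  rcases lt_or_gt_of_ne hne with h | h
  · exact Or.inr ⟨hx, y, hy, h⟩
  · exact Or.inl ⟨hx, y, hy, h⟩

/-! ### Properness and range of the recursive colouring -/

/-- Equal codes would give the same position and the same digit of `a` and `b` there, but `a` and
`b` differ at that position. -/
theorem bitStep_ne {a b c : ℕ} (hab : a ≠ b) (hbc : b ≠ c) : bitStep a b ≠ bitStep b c := by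
  intro h
  rw [bitStep, bitStep, dif_neg hab, dif_neg hbc] at h
  have h1 := Nat.find_spec (exists_testBit_ne hab)
  set i := Nat.find (exists_testBit_ne hab)
  set j := Nat.find (exists_testBit_ne hbc)
  have hi := Bool.toNat_lt (a.testBit i)
  have hj := Bool.toNat_lt (b.testBit j)
  have hij : i = j := by omega
  have ht : (a.testBit i).toNat = (b.testBit j).toNat := by omega
  rw [← hij] at ht
  apply h1
  cases hA : a.testBit i <;> cases hB : b.testBit i <;> simp_all

theorem bitStep_lt {a b s : ℕ} (hs : 0 < s) (ha : a < 2 ^ s) (hb : b < 2 ^ s) :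
    bitStep a b < 2 * s := by
  rw [bitStep]
  split_ifs with h
  · omega
  · have h1 := Nat.find_spec (exists_testBit_ne h)
    set i := Nat.find (exists_testBit_ne h)
    have hi : i < s := by
      by_contra hc
      have h2 : 2 ^ s ≤ 2 ^ i := Nat.pow_le_pow_right (by norm_num) (by omega)
      exact h1 (by rw [Nat.testBit_lt_two_pow (ha.trans_le h2),
        Nat.testBit_lt_two_pow (hb.trans_le h2)])
    have := Bool.toNat_lt (a.testBit i)
    omega

theorem bitColor_ne {N : ℕ} (j : ℕ) : ∀ D : Finset ℕ, D ⊆ Finset.Icc 1 N → D.card = j + 2 →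
    bitColor j (dropMax D) ≠ bitColor j (dropMin D) := by
  induction j with
  | zero =>
    intro D hD hc
    obtain ⟨a, ha⟩ := Finset.card_eq_one.1 (card_dropMax hc)
    obtain ⟨b, hb⟩ := Finset.card_eq_one.1 (card_dropMin hc)
    have ha' : a ∈ dropMax D := by simp [ha]
    have hb' : b ∈ dropMin D := by simp [hb]
    -- Elements are at least 1, so the truncated `- 1` is injective on them.
    have h1 := Finset.mem_Icc.1 (hD (dropMax_subset D ha'))
    have h2 := Finset.mem_Icc.1 (hD (dropMin_subset D hb'))
    obtain ⟨h3, y, hy, hay⟩ := mem_dropMax.1 ha'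
    have hyb : y ∈ dropMin D := mem_dropMin.2 ⟨hy, a, h3, hay⟩
    rw [hb, Finset.mem_singleton] at hyb
    simp only [bitColor, ha, hb, Finset.sup_singleton, id]
    omega
  | succ j ih =>
    intro D hD hc
    have h1 := ih (dropMax D) ((dropMax_subset D).trans hD) (card_dropMax hc)
    have h2 := ih (dropMin D) ((dropMin_subset D).trans hD) (card_dropMin hc)
    rw [dropMax_dropMin] at h2
    rw [bitColor, bitColor, dropMax_dropMin]
    exact bitStep_ne h1 h2

theorem two_le_tw (i : ℕ) : 2 ≤ tw (i + 1) 2 := by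
  induction i with
  | zero => simp [tw]
  | succ i ih =>
    rw [tw]
    calc 2 = 2 ^ 1 := rfl
      _ ≤ 2 ^ tw (i + 1) 2 := Nat.pow_le_pow_right (by norm_num) (by omega)

/-- The parameter `h` counts the tower levels still left after `j` bit steps. The factor 4 survives
each step: colours below `4 * 2 ^ t = 2 ^ (t + 2)` become colours below `2 * (t + 2) ≤ 4 * t`, as `t
≥ 2`. -/
theorem bitColor_lt {N : ℕ} (j : ℕ) : ∀ (h : ℕ) (X : Finset ℕ), N ≤ 4 * tw (h + j + 1) 2 →
    X ⊆ Finset.Icc 1 N → X.card = j + 1 → bitColor j X < 4 * tw (h + 1) 2 := by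
  induction j with
  | zero =>
    intro h X hN hX hc
    obtain ⟨a, rfl⟩ := Finset.card_eq_one.1 hc
    have h1 := Finset.mem_Icc.1 (hX (Finset.mem_singleton_self a))
    simp only [bitColor, Finset.sup_singleton, id]
    simp only [add_zero] at hN
    omega
  | succ j ih =>
    intro h X hN hX hc
    have hN' : N ≤ 4 * tw (h + 1 + j + 1) 2 := by
      rwa [show h + 1 + j + 1 = h + (j + 1) + 1 by ring]
    have h1 := ih (h + 1) (dropMax X) hN' ((dropMax_subset X).trans hX) (card_dropMax hc)
    have h2 := ih (h + 1) (dropMin X) hN' ((dropMin_subset X).trans hX) (card_dropMin hc)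
    have h3 : 4 * tw (h + 1 + 1) 2 = 2 ^ (tw (h + 1) 2 + 2) := by
      rw [tw, pow_add]; ring
    rw [h3] at h1 h2
    have h4 := bitStep_lt (by omega) h1 h2
    have h5 := two_le_tw h
    rw [bitColor]
    omega

theorem middleLayer_subset (s a : ℕ) : middleLayer s a ⊆ Finset.range (2 * s) := by
  rw [middleLayer, List.getD_eq_getElem?_getD]
  rcases h : (_ : List (Finset ℕ))[a]? with _ | A
  · simp
  · have := List.mem_of_getElem? h
    simp only [List.mem_filter, List.mem_map] at this
    obtain ⟨⟨b, -, rfl⟩, -⟩ := this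
    exact Finset.filter_subset _ _

/-- The list of the `s`-element subsets of `{0, …, 2 * s - 1}` in the order of their codes. -/
def middleLayerList (s : ℕ) : List (Finset ℕ) :=
  ((List.range (2 ^ (2 * s))).map
      (fun b => (Finset.range (2 * s)).filter (fun i => b.testBit i = true))).filter
    (fun A => A.card = s)

theorem nodup_middleLayerList (s : ℕ) : (middleLayerList s).Nodup := by
  refine List.Nodup.filter _ (List.Nodup.map_on ?_ List.nodup_range)
  intro a ha b hb hab
  rw [List.mem_range] at ha hb
  refine Nat.eq_of_testBit_eq fun i => ?_
  by_cases hi : i < 2 * s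
  · have h := congrArg (fun A => i ∈ A) hab
    simp only [Finset.mem_filter, Finset.mem_range, hi, true_and, eq_iff_iff] at h
    exact Bool.eq_iff_iff.2 h
  · have h2 : 2 ^ (2 * s) ≤ 2 ^ i := Nat.pow_le_pow_right (by norm_num) (by omega)
    rw [Nat.testBit_lt_two_pow (ha.trans_le h2), Nat.testBit_lt_two_pow (hb.trans_le h2)]

theorem spernerStep_mem {s a b : ℕ} (ha : a < (middleLayerList s).length)
    (hb : b < (middleLayerList s).length) (hab : a ≠ b) :
    spernerStep s a b ∈ middleLayer s a \ middleLayer s b := by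
  have hA : middleLayer s a = (middleLayerList s)[a] := List.getD_eq_getElem _ _ ha
  have hB : middleLayer s b = (middleLayerList s)[b] := List.getD_eq_getElem _ _ hb
  have hcA : (middleLayer s a).card = s := by
    rw [hA]; simpa using (List.mem_filter.1 (List.getElem_mem ha)).2
  have hcB : (middleLayer s b).card = s := by
    rw [hB]; simpa using (List.mem_filter.1 (List.getElem_mem hb)).2
  have hne : middleLayer s a ≠ middleLayer s b := by
    rw [hA, hB]
    exact fun h => hab ((nodup_middleLayerList s).getElem_inj_iff.1 h)
  have hn : (middleLayer s a \ middleLayer s b).Nonempty := by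
    rw [Finset.sdiff_nonempty]
    exact fun h => hne (Finset.eq_of_subset_of_card_le h (by omega))
  rw [spernerStep, ← Finset.coe_min' hn, WithTop.untopD_coe]
  exact Finset.min'_mem _ hn

theorem spernerStep_lt {s a b : ℕ} (ha : a < (middleLayerList s).length)
    (hb : b < (middleLayerList s).length) (hab : a ≠ b) : spernerStep s a b < 2 * s :=
  Finset.mem_range.1 (middleLayer_subset s a (Finset.mem_sdiff.1 (spernerStep_mem ha hb hab)).1)

/-- A common value would lie outside the middle set and inside it. -/
theorem spernerStep_ne {s a b c : ℕ} (ha : a < (middleLayerList s).length)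
    (hb : b < (middleLayerList s).length) (hc : c < (middleLayerList s).length)
    (hab : a ≠ b) (hbc : b ≠ c) : spernerStep s a b ≠ spernerStep s b c := fun h =>
  (Finset.mem_sdiff.1 (spernerStep_mem ha hb hab)).2
    (h ▸ (Finset.mem_sdiff.1 (spernerStep_mem hb hc hbc)).1)

theorem length_middleLayerList_three : (middleLayerList 3).length = 20 := by decide +kernel

theorem length_middleLayerList_two : (middleLayerList 2).length = 6 := by decide +kernel

section Colors

variable {N j : ℕ} (hN : N ≤ 4 * tw (j + 2) 2)
include hN

theorem bitColor_lt_length {X : Finset ℕ} (hX : X ⊆ Finset.Icc 1 N) (hc : X.card = j + 1) :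
    bitColor j X < (middleLayerList 3).length := by
  -- With one level left the bound is `4 * tw 2 2 = 16 ≤ 20`.
  have := bitColor_lt j 1 X (by rwa [show 1 + j + 1 = j + 2 by ring]) hX hc
  rw [length_middleLayerList_three]
  simp only [tw] at this
  omega

theorem sixColor_lt {X : Finset ℕ} (hX : X ⊆ Finset.Icc 1 N) (hc : X.card = j + 2) :
    sixColor j X < 6 :=
  spernerStep_lt (bitColor_lt_length hN ((dropMax_subset X).trans hX) (card_dropMax hc))
    (bitColor_lt_length hN ((dropMin_subset X).trans hX) (card_dropMin hc)) (bitColor_ne j X hX hc)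

theorem sixColor_ne {D : Finset ℕ} (hD : D ⊆ Finset.Icc 1 N) (hc : D.card = j + 3) :
    sixColor j (dropMax D) ≠ sixColor j (dropMin D) := by
  have hM := (dropMax_subset D).trans hD
  have hm := (dropMin_subset D).trans hD
  have h2 := bitColor_ne j (dropMin D) hm (card_dropMin hc)
  rw [dropMax_dropMin] at h2
  rw [sixColor, sixColor, dropMax_dropMin]
  exact spernerStep_ne
    (bitColor_lt_length hN ((dropMax_subset _).trans hM) (card_dropMax (card_dropMax hc)))
    (bitColor_lt_length hN ((dropMin_subset _).trans hM) (card_dropMin (card_dropMax hc)))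
    (bitColor_lt_length hN ((dropMin_subset _).trans hm) (card_dropMin (card_dropMin hc)))
    (bitColor_ne j (dropMax D) hM (card_dropMax hc)) h2

theorem sixColor_lt_length {X : Finset ℕ} (hX : X ⊆ Finset.Icc 1 N) (hc : X.card = j + 2) :
    sixColor j X < (middleLayerList 2).length := by
  rw [length_middleLayerList_two]
  exact sixColor_lt hN hX hc

theorem fourColor_lt {X : Finset ℕ} (hX : X ⊆ Finset.Icc 1 N) (hc : X.card = j + 3) :
    fourColor j X < 4 :=
  spernerStep_lt (sixColor_lt_length hN ((dropMax_subset X).trans hX) (card_dropMax hc))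
    (sixColor_lt_length hN ((dropMin_subset X).trans hX) (card_dropMin hc)) (sixColor_ne hN hX hc)

theorem fourColor_ne {D : Finset ℕ} (hD : D ⊆ Finset.Icc 1 N) (hc : D.card = j + 4) :
    fourColor j (dropMax D) ≠ fourColor j (dropMin D) := by
  have hM := (dropMax_subset D).trans hD
  have hm := (dropMin_subset D).trans hD
  have h2 := sixColor_ne hN hm (card_dropMin hc)
  rw [dropMax_dropMin] at h2
  rw [fourColor, fourColor, dropMax_dropMin]
  exact spernerStep_ne
    (sixColor_lt_length hN ((dropMax_subset _).trans hM) (card_dropMax (card_dropMax hc)))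
    (sixColor_lt_length hN ((dropMin_subset _).trans hM) (card_dropMin (card_dropMax hc)))
    (sixColor_lt_length hN ((dropMin_subset _).trans hm) (card_dropMin (card_dropMin hc)))
    (sixColor_ne hN hM (card_dropMax hc)) h2

end Colors

theorem threeStep_lt : ∀ a < 4, ∀ b < 4, ∀ c < 4, threeStep a b c < 3 := by decide

/-- If neither `b` nor `c` is 3, the colours are `b` and `c`. If one of them is 3, its replacement
colour avoids both neighbours on the path. -/
theorem threeStep_ne_fin : ∀ a b c d : Fin 4, a ≠ b → b ≠ c → c ≠ d →
    threeStep a b c ≠ threeStep b c d := by decide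

theorem threeStep_ne {a b c d : ℕ} (ha : a < 4) (hb : b < 4) (hc : c < 4) (hd : d < 4)
    (hab : a ≠ b) (hbc : b ≠ c) (hcd : c ≠ d) : threeStep a b c ≠ threeStep b c d :=
  threeStep_ne_fin ⟨a, ha⟩ ⟨b, hb⟩ ⟨c, hc⟩ ⟨d, hd⟩ (by simpa using hab) (by simpa using hbc)
    (by simpa using hcd)

theorem shiftColor_lt {N l : ℕ} (hl : 5 ≤ l) (hN : N ≤ 4 * tw (l - 3) 2) {X : Finset ℕ}
    (hX : X ⊆ Finset.Icc 1 N) (hc : X.card = l) : shiftColor l X < 3 := by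
  obtain ⟨j, rfl⟩ := Nat.exists_eq_add_of_le' hl
  have hN' : N ≤ 4 * tw (j + 2) 2 := hN
  have hM := (dropMax_subset X).trans hX
  have hm := (dropMin_subset X).trans hX
  exact threeStep_lt
    _ (fourColor_lt hN' ((dropMax_subset _).trans hM) (card_dropMax (card_dropMax hc)))
    _ (fourColor_lt hN' ((dropMin_subset _).trans hM) (card_dropMin (card_dropMax hc)))
    _ (fourColor_lt hN' ((dropMin_subset _).trans hm) (card_dropMin (card_dropMin hc)))

theorem shiftColor_ne {N l : ℕ} (hl : 5 ≤ l) (hN : N ≤ 4 * tw (l - 3) 2) {D : Finset ℕ}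
    (hD : D ⊆ Finset.Icc 1 N) (hc : D.card = l + 1) :
    shiftColor l (dropMax D) ≠ shiftColor l (dropMin D) := by
  obtain ⟨j, rfl⟩ := Nat.exists_eq_add_of_le' hl
  have hN' : N ≤ 4 * tw (j + 2) 2 := hN
  have hM := (dropMax_subset D).trans hD
  have hm := (dropMin_subset D).trans hD
  have hMM := (dropMax_subset _).trans hM
  have hMm := (dropMin_subset _).trans hM
  have hmm := (dropMin_subset _).trans hm
  have cMM := card_dropMax (card_dropMax hc)
  have cMm := card_dropMin (card_dropMax hc)
  have cmm := card_dropMin (card_dropMin hc)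
  have h1 := fourColor_ne hN' hMM cMM
  have h2 := fourColor_ne hN' hMm cMm
  have h3 := fourColor_ne hN' hmm cmm
  rw [dropMax_dropMin] at h2
  rw [dropMax_dropMin, dropMax_dropMin] at h3
  rw [shiftColor, shiftColor, dropMax_dropMin, dropMax_dropMin]
  exact threeStep_ne
    (fourColor_lt hN' ((dropMax_subset _).trans hMM) (card_dropMax cMM))
    (fourColor_lt hN' ((dropMin_subset _).trans hMM) (card_dropMin cMM))
    (fourColor_lt hN' ((dropMin_subset _).trans hMm) (card_dropMin cMm))
    (fourColor_lt hN' ((dropMin_subset _).trans hmm) (card_dropMin cmm)) h1 h2 h3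

/-- `shiftColor` is a proper 3-colouring of the shift graph. -/
theorem exists_coloring_shiftColor {N l : ℕ} (hl : 5 ≤ l) (hN : N ≤ 4 * tw (l - 3) 2) :
    ∃ κ : (shiftGraph N l).Coloring (Fin 3), ∀ X, (κ X : ℕ) = shiftColor l X.1 := by
  have hlt : ∀ X : {X : Finset ℕ // X ∈ (Finset.Icc 1 N).powersetCard l}, shiftColor l X.1 < 3 :=
    fun X => shiftColor_lt hl hN (Finset.mem_powersetCard.1 X.2).1 (Finset.mem_powersetCard.1 X.2).2
  have key : ∀ A B : {X : Finset ℕ // X ∈ (Finset.Icc 1 N).powersetCard l},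
      ShiftPosition l A.1 B.1 → shiftColor l A.1 ≠ shiftColor l B.1 := by
    rintro ⟨A, hA⟩ ⟨B, hB⟩ ⟨D, hD, hDA, hDB⟩
    simp only at hDA hDB ⊢
    have hsub : D ⊆ Finset.Icc 1 N := by
      rw [← dropMax_union_dropMin (by omega : 2 ≤ D.card), ← hDA, ← hDB]
      exact Finset.union_subset (Finset.mem_powersetCard.1 hA).1 (Finset.mem_powersetCard.1 hB).1
    rw [hDA, hDB]
    exact shiftColor_ne hl hN hsub hD
  refine ⟨SimpleGraph.Coloring.mk (fun X => ⟨shiftColor l X.1, hlt X⟩) ?_, fun X => rfl⟩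
  intro A B hAB h
  rw [Fin.mk.injEq] at h
  rw [shiftGraph, SimpleGraph.fromRel_adj] at hAB
  rcases hAB.2 with h1 | h1
  · exact key A B h1 h
  · exact key B A h1 h.symm

/-! ### Random scans and the gain per block -/

/-- Scan the list, keeping each entry with weight `p` and dropping it with weight `1 - p`. The kept
entries are collected in the current block, and a block that reaches size `l` contributes the
factor `φ` of it. The value is the total weight of the scans that, from the current block `B` on,
complete exactly `j` blocks and leave no entry over. -/
noncomputable def blockWeight (p : ℝ) (l : ℕ) (φ : Finset ℕ → ℂ) : List ℕ → Finset ℕ → ℕ → ℂ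
  | [], B, j => if B = ∅ ∧ j = 0 then 1 else 0
  | _ :: L, B, 0 => (1 - p) * blockWeight p l φ L B 0
  | x :: L, B, j + 1 => (1 - p) * blockWeight p l φ L B (j + 1) +
      p * (if (insert x B).card = l then φ (insert x B) * blockWeight p l φ L ∅ j
        else blockWeight p l φ L (insert x B) (j + 1))

theorem norm_convex_le {p M : ℝ} (hp0 : 0 ≤ p) (hp1 : p ≤ 1) {u v : ℂ} (hu : ‖u‖ ≤ M)
    (hv : ‖v‖ ≤ M) : ‖(1 - p : ℂ) * u + p * v‖ ≤ M := by
  have h1 : ‖(1 - p : ℂ)‖ = 1 - p := by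
    rw [← Complex.ofReal_one, ← Complex.ofReal_sub, Complex.norm_real, Real.norm_of_nonneg]
    linarith
  have h2 : ‖(p : ℂ)‖ = p := by rw [Complex.norm_real, Real.norm_of_nonneg hp0]
  calc _ ≤ ‖(1 - p : ℂ) * u‖ + ‖(p : ℂ) * v‖ := norm_add_le _ _
    _ = (1 - p) * ‖u‖ + p * ‖v‖ := by rw [norm_mul, norm_mul, h1, h2]
    _ ≤ (1 - p) * M + p * M := by gcongr
    _ = M := by ring

theorem norm_unit_mul_le {a u : ℂ} {M : ℝ} (ha : ‖a‖ ≤ 1) (hu : ‖u‖ ≤ M) : ‖a * u‖ ≤ M := by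
  rw [norm_mul]
  calc ‖a‖ * ‖u‖ ≤ 1 * ‖u‖ := by gcongr
    _ ≤ M := by rwa [one_mul]

section Weight

variable {p : ℝ} {l : ℕ} {φ : Finset ℕ → ℂ}

theorem norm_blockWeight_zero_le (hp0 : 0 ≤ p) (hp1 : p ≤ 1) (L : List ℕ) (B : Finset ℕ) :
    ‖blockWeight p l φ L B 0‖ ≤ 1 := by
  induction L with
  | nil => rw [blockWeight]; split_ifs <;> simp
  | cons x L ih =>
    rw [blockWeight]
    simpa using norm_convex_le hp0 hp1 ih (v := 0) (by simp)

/-- Every contributing scan first completes its current block and then stands at an empty block with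
`j` to go. The weight is therefore a subconvex combination of such states, times factors of norm at
most 1. -/
theorem norm_blockWeight_succ_le (hp0 : 0 ≤ p) (hp1 : p ≤ 1) (hφ : ∀ B, ‖φ B‖ ≤ 1)
    {L₀ : List ℕ} {j : ℕ} {M : ℝ} (hM0 : 0 ≤ M)
    (hM : ∀ L, L <:+ L₀ → ‖blockWeight p l φ L ∅ j‖ ≤ M) (L : List ℕ) :
    ∀ B, L <:+ L₀ → ‖blockWeight p l φ L B (j + 1)‖ ≤ M := by
  induction L with
  | nil => intro B _; rw [blockWeight]; simpa using hM0
  | cons x L ih =>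
    intro B hL
    have hL' : L <:+ L₀ := (List.suffix_cons x L).trans hL
    rw [blockWeight]
    refine norm_convex_le hp0 hp1 (ih B hL') ?_
    split_ifs
    · exact norm_unit_mul_le (hφ _) (hM L hL')
    · exact ih _ hL'

theorem blockWeight_eq_zero (L : List ℕ) :
    ∀ B j, L.length + B.card < j * l → blockWeight p l φ L B j = 0 := by
  induction L with
  | nil =>
    intro B j h
    rw [blockWeight, if_neg]
    rintro ⟨-, rfl⟩
    simp at h
  | cons x L ih =>
    intro B j h
    rcases j with _ | j
    · simp at h
    have hc := Finset.card_insert_le x B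
    rw [List.length_cons] at h
    rw [blockWeight, ih B (j + 1) (by omega)]
    split_ifs with hl
    · rw [ih ∅ j (by rw [add_one_mul] at h; simp only [Finset.card_empty]; omega)]
      simp
    · rw [ih (insert x B) (j + 1) (by omega)]
      simp

/-- The scans that keep the next `l - |B|` entries form the main term. -/
theorem norm_blockWeight_append_sub_le (hp0 : 0 ≤ p) (hp1 : p ≤ 1)
    {L₀ L' : List ℕ} {j : ℕ} {M : ℝ}
    (hM : ∀ L B, L <:+ L₀ → ‖blockWeight p l φ L B (j + 1)‖ ≤ M) (D : List ℕ) :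
    ∀ B : Finset ℕ, D ≠ [] → D ++ L' <:+ L₀ → B.card + D.length = l →
      (B ∪ D.toFinset).card = l →
      ‖blockWeight p l φ (D ++ L') B (j + 1) -
        p ^ D.length * (φ (B ∪ D.toFinset) * blockWeight p l φ L' ∅ j)‖ ≤
        (1 - p ^ D.length) * M := by
  induction D with
  | nil => intro B h; exact absurd rfl h
  | cons x D ih =>
    intro B _ hL hl hc
    have hL' : D ++ L' <:+ L₀ := (List.suffix_cons x _).trans hL
    have hu : B ∪ (x :: D).toFinset = insert x B ∪ D.toFinset := by
      ext y; simp
    have h1 : ‖(1 - p : ℂ)‖ = 1 - p := by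
      rw [← Complex.ofReal_one, ← Complex.ofReal_sub, Complex.norm_real, Real.norm_of_nonneg]
      linarith
    have h2 : ‖(p : ℂ)‖ = p := by rw [Complex.norm_real, Real.norm_of_nonneg hp0]
    rw [hu] at hc ⊢
    rw [List.length_cons] at hl ⊢
    have hA := hM (D ++ L') B hL'
    rw [List.cons_append, blockWeight]
    rcases eq_or_ne D [] with rfl | hD
    · simp only [List.toFinset_nil, Finset.union_empty] at hc
      rw [if_pos hc]
      simp only [List.nil_append, List.toFinset_nil, Finset.union_empty, List.length_nil, zero_add,
        pow_one, add_sub_cancel_right, norm_mul, h1]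
      simp only [List.nil_append] at hA
      exact mul_le_mul_of_nonneg_left hA (by linarith)
    · have h3 : D.length ≠ 0 := by simpa using hD
      have h4 := Finset.card_insert_le x B
      have h5 := Finset.card_union_le (insert x B) D.toFinset
      have h6 := D.toFinset_card_le
      rw [if_neg (by omega)]
      have h7 := ih (insert x B) hD hL' (by omega) hc
      set W := blockWeight p l φ (D ++ L') B (j + 1)
      set V := blockWeight p l φ (D ++ L') (insert x B) (j + 1)
      set T := φ (insert x B ∪ D.toFinset) * blockWeight p l φ L' ∅ j
      calc ‖(1 - p : ℂ) * W + p * V - p ^ (D.length + 1) * T‖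
          = ‖(1 - p : ℂ) * W + p * (V - p ^ D.length * T)‖ := by congr 1; ring
        _ ≤ ‖(1 - p : ℂ) * W‖ + ‖(p : ℂ) * (V - p ^ D.length * T)‖ := norm_add_le _ _
        _ = (1 - p) * ‖W‖ + p * ‖V - p ^ D.length * T‖ := by rw [norm_mul, norm_mul, h1, h2]
        _ ≤ (1 - p) * M + p * ((1 - p ^ D.length) * M) := by gcongr
        _ = (1 - p ^ (D.length + 1)) * M := by ring

/-- The scans that drop exactly the first or exactly the last of the next `l + 1` entries
partly cancel. -/
theorem norm_blockWeight_window_le (hp0 : 0 ≤ p) (hp1 : p ≤ 1) (hφ : ∀ B, ‖φ B‖ ≤ 1)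
    {L₀ L' D : List ℕ} {x y j : ℕ} {η M M' : ℝ} (hD : D.length + 1 = l) (hD0 : D ≠ [])
    (hM : ∀ L, L <:+ L₀ → ‖blockWeight p l φ L ∅ j‖ ≤ M)
    (hM' : ∀ L B, L <:+ L₀ → ‖blockWeight p l φ L B j‖ ≤ M')
    (hL : x :: (D ++ y :: L') <:+ L₀) (hs : (x :: (D ++ y :: L')).Nodup)
    (hη : ‖φ (insert x D.toFinset) + φ (insert y D.toFinset)‖ ≤ 2 - η) :
    ‖blockWeight p l φ (x :: (D ++ y :: L')) ∅ (j + 1)‖ ≤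
      M - (1 - p) * p ^ l * η * M + p ^ (l + 1) * (M' - M) := by
  have hL1 : D ++ y :: L' <:+ L₀ := (List.suffix_cons x _).trans hL
  have hL2 : y :: L' <:+ L₀ := (List.suffix_append D _).trans hL1
  have hL3 : L' <:+ L₀ := (List.suffix_cons y _).trans hL2
  have hM0 : 0 ≤ M := (norm_nonneg _).trans (hM L' hL3)
  have hM'0 : 0 ≤ M' := (norm_nonneg _).trans (hM' L' ∅ hL3)
  have hQ := norm_blockWeight_succ_le hp0 hp1 hφ hM0 hM
  have hnd : (x :: (D ++ [y])).Nodup := by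
    refine hs.sublist ?_
    simp
  simp only [List.nodup_cons, List.mem_append, List.mem_singleton, not_or, List.nodup_append,
    List.nodup_nil] at hnd
  obtain ⟨⟨hxD, hxy⟩, hDn, -, hDy⟩ := hnd
  have hcD : D.toFinset.card = D.length := List.toFinset_card_of_nodup hDn
  have hD1 : 1 ≤ D.length := List.length_pos_iff.2 hD0
  have E1 := norm_blockWeight_append_sub_le hp0 hp1 (L' := L') hQ (D ++ [y]) ∅ (by simp)
    (by simpa using hL1) (by simpa using hD) (by
      rw [Finset.empty_union, List.toFinset_card_of_nodup (by
        simp only [List.nodup_append, hDn, List.nodup_singleton, true_and]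
        exact fun a ha b hb => hDy a ha b (List.mem_singleton.1 hb)), List.length_append, List.length_singleton, hD])
  have E2 := norm_blockWeight_append_sub_le hp0 hp1 (L' := y :: L') hQ D {x} hD0
    hL1 (by simpa [add_comm] using hD) (by
      rw [← Finset.insert_eq, Finset.card_insert_of_notMem (by simpa using hxD), hcD, hD])
  have hu1 : (∅ ∪ (D ++ [y]).toFinset : Finset ℕ) = insert y D.toFinset := by
    ext z; simp
  have hu2 : ({x} ∪ D.toFinset : Finset ℕ) = insert x D.toFinset := rfl
  -- If `x` is kept, the block is already full before `y`. Only the scans dropping `y` reach the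
  -- state `T`; those keeping `y` start a new block, whence the weaker bound `M'` for `Y`. For `j =
  -- 0` keeping `y` contributes nothing.
  have hZ : ∃ Y : ℂ, ‖Y‖ ≤ M' ∧ blockWeight p l φ (y :: L') ∅ j =
      (1 - p : ℂ) * blockWeight p l φ L' ∅ j + p * Y := by
    rcases j with _ | j
    · exact ⟨0, by simpa using hM'0, by rw [blockWeight]; simp⟩
    · refine ⟨blockWeight p l φ L' (insert y ∅) (j + 1), hM' _ _ hL3, ?_⟩
      rw [blockWeight, if_neg (by simp; omega)]
  obtain ⟨Y, hY, hZ⟩ := hZ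
  rw [hu1] at E1
  rw [hu2, hZ] at E2
  have hlen : (D ++ [y]).length = l := by simpa using hD
  have happ : D ++ [y] ++ L' = D ++ y :: L' := by simp
  rw [hlen, happ] at E1
  rw [blockWeight, if_neg (by simp; omega), insert_empty_eq]
  have hTM := hM L' hL3
  have ha := hφ (insert x D.toFinset)
  set a := φ (insert x D.toFinset)
  set b := φ (insert y D.toFinset)
  set W1 := blockWeight p l φ (D ++ y :: L') ∅ (j + 1)
  set W2 := blockWeight p l φ (D ++ y :: L') {x} (j + 1)
  set T := blockWeight p l φ L' ∅ j
  set R1 := W1 - p ^ l * (b * T) with hR1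
  set R2 := W2 - p ^ D.length * (a * ((1 - p : ℂ) * T + p * Y)) with hR2
  have hpl : (p : ℂ) ^ l = p ^ D.length * p := by rw [← pow_succ, hD]
  have hplr : p ^ l = p ^ D.length * p := by rw [← pow_succ, hD]
  -- The two cancelling scans give `(a + b) * T`; `R1` and `R2` are the deviating scans, and the
  -- last term keeps all of `x, D, y`.
  have key : (1 - p : ℂ) * W1 + p * W2 =
      ((1 - p : ℝ) * p ^ l : ℂ) * ((a + b) * T) + (1 - p : ℝ) * R1 + (p : ℂ) * R2 +
        (p : ℂ) ^ (l + 1) * (a * Y) := by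
    rw [hR1, hR2, pow_succ, hpl]; push_cast; ring
  have h1p : (0 : ℝ) ≤ 1 - p := by linarith
  have n1 : ‖((1 - p : ℝ) : ℂ)‖ = 1 - p := by rw [Complex.norm_real, Real.norm_of_nonneg h1p]
  have n2 : ‖(p : ℂ)‖ = p := by rw [Complex.norm_real, Real.norm_of_nonneg hp0]
  have hab : ‖(a + b) * T‖ ≤ (2 - η) * M := by
    rw [norm_mul]
    exact mul_le_mul hη hTM (norm_nonneg _) ((norm_nonneg _).trans hη)
  rw [key]
  calc _ ≤ ‖((1 - p : ℝ) * p ^ l : ℂ) * ((a + b) * T)‖ + ‖((1 - p : ℝ) : ℂ) * R1‖ +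
        ‖(p : ℂ) * R2‖ + ‖(p : ℂ) ^ (l + 1) * (a * Y)‖ := norm_add₄_le
    _ = (1 - p) * p ^ l * ‖(a + b) * T‖ + (1 - p) * ‖R1‖ + p * ‖R2‖ +
        p ^ (l + 1) * ‖a * Y‖ := by
      rw [norm_mul _ ((a + b) * T), norm_mul _ ((p : ℂ) ^ l), norm_mul _ R1, norm_mul _ R2,
        norm_mul _ (a * Y), norm_pow, norm_pow, n1, n2]
    _ ≤ (1 - p) * p ^ l * ((2 - η) * M) + (1 - p) * ((1 - p ^ l) * M) +
        p * ((1 - p ^ D.length) * M) + p ^ (l + 1) * M' := by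
      gcongr
      exact norm_unit_mul_le ha hY
    _ = _ := by rw [pow_succ, hplr]; ring

/-- Each block beyond the first one costs a factor `1 - g`. -/
theorem norm_blockWeight_le (hp0 : 0 ≤ p) (hp1 : p ≤ 1) (hφ : ∀ B, ‖φ B‖ ≤ 1) (hl : 2 ≤ l)
    {η g : ℝ} (hg0 : 0 ≤ g) (hg : g ≤ 1 / 2) (hgη : 3 * g ≤ (1 - p) * p ^ l * η)
    {L₀ : List ℕ} (hL₀ : L₀.Nodup)
    (hη : ∀ x D y L', x :: (D ++ y :: L') <:+ L₀ → D.length + 1 = l →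
      ‖φ (insert x D.toFinset) + φ (insert y D.toFinset)‖ ≤ 2 - η) (j : ℕ) :
    (∀ L, L <:+ L₀ → ‖blockWeight p l φ L ∅ j‖ ≤ (1 - g) ^ j / (1 - g)) ∧
      ∀ L B, L <:+ L₀ → ‖blockWeight p l φ L B j‖ ≤ (1 - g) ^ j / (1 - g) / (1 - g) := by
  have hθ : 0 < 1 - g := by linarith
  have hθ1 : 1 - g ≤ 1 := by linarith
  induction j with
  | zero =>
    have h1 : 1 ≤ 1 / (1 - g) := by rw [le_div_iff₀ hθ]; linarith
    have h2 : 1 ≤ 1 / (1 - g) / (1 - g) := by rw [le_div_iff₀ hθ]; linarith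
    simp only [pow_zero]
    exact ⟨fun L _ => (norm_blockWeight_zero_le hp0 hp1 _ _).trans h1,
      fun L B _ => (norm_blockWeight_zero_le hp0 hp1 _ _).trans h2⟩
  | succ j ih =>
    obtain ⟨ihP, ihQ⟩ := ih
    have hMn : 0 ≤ (1 - g) ^ j / (1 - g) := by positivity
    refine ⟨fun L hL => ?_, fun L B hL => ?_⟩
    -- The first block gains nothing: with a single block left the list may be too short for a
    -- window of `l + 1` entries. For `j ≥ 1` a list of length at most `l` has weight zero.
    · rcases Nat.eq_zero_or_pos j with rfl | hj
      · rw [zero_add, pow_one, div_self hθ.ne']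
        exact norm_blockWeight_succ_le hp0 hp1 hφ zero_le_one
          (fun L _ => norm_blockWeight_zero_le hp0 hp1 _ _) L ∅ hL
      by_cases hlen : L.length ≤ l
      · rw [blockWeight_eq_zero L ∅ (j + 1) (by
          rw [Finset.card_empty]; nlinarith), norm_zero]
        positivity
      · rcases L with _ | ⟨x, L⟩
        · simp at hlen
        rw [List.length_cons] at hlen
        have hsplit : L = L.take (l - 1) ++ L.drop (l - 1) := (List.take_append_drop _ _).symm
        have hDlen : (L.take (l - 1)).length = l - 1 := by rw [List.length_take]; omega
        have hRlen : (L.drop (l - 1)).length ≠ 0 := by rw [List.length_drop]; omega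
        generalize L.take (l - 1) = D at hsplit hDlen
        generalize L.drop (l - 1) = R at hsplit hRlen
        rcases R with _ | ⟨y, L'⟩
        · simp at hRlen
        subst hsplit
        have h := norm_blockWeight_window_le hp0 hp1 hφ (by omega)
          (List.length_pos_iff.1 (by omega)) ihP ihQ hL (hL₀.sublist hL.sublist)
          (hη x D y L' hL (by omega))
        refine h.trans ?_
        set M := (1 - g) ^ j / (1 - g) with hMdef
        have e1 : (1 - g) ^ (j + 1) / (1 - g) = (1 - g) * M := by rw [hMdef]; ring
        -- The window gains at least `3 * g * M`, and replacing `M` by `M'` loses at most `2 * g *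
        -- M`; the net gain is `g * M`.
        have e2 : M / (1 - g) - M ≤ 2 * g * M := by
          have : M / (1 - g) ≤ (1 + 2 * g) * M := by
            rw [div_le_iff₀ hθ]
            nlinarith [mul_nonneg (mul_nonneg hMn hg0) (by linarith : 0 ≤ 1 - 2 * g)]
          linarith
        have e3 : p ^ (l + 1) * (M / (1 - g) - M) ≤ M / (1 - g) - M := by
          have h0 : 0 ≤ M / (1 - g) - M := by
            rw [sub_nonneg, le_div_iff₀ hθ]; nlinarith
          exact mul_le_of_le_one_left h0 (pow_le_one₀ hp0 hp1)
        have e4 := mul_le_mul_of_nonneg_right hgη hMn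
        rw [e1]
        linarith
    · have e : (1 - g) ^ (j + 1) / (1 - g) / (1 - g) = (1 - g) ^ j / (1 - g) := by
        rw [pow_succ', mul_div_assoc, mul_div_cancel_left₀ _ hθ.ne']
      rw [e]
      exact norm_blockWeight_succ_le hp0 hp1 hφ hMn ihP L B hL

end Weight

/-! ### Closed form of the scan weight -/

section Blocks

variable {l : ℕ} {B X : Finset ℕ}

theorem card_filter_lt_of_mem_left (hBX : ∀ b ∈ B, ∀ x ∈ X, b < x) {x : ℕ} (hx : x ∈ B) :
    ((B ∪ X).filter (fun y => y < x)).card < B.card := by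
  refine Finset.card_lt_card ⟨fun y hy => ?_, fun h => ?_⟩
  · rw [Finset.mem_filter, Finset.mem_union] at hy
    rcases hy.1 with h | h
    · exact h
    · exact absurd hy.2 (hBX x hx y h).not_gt
  · exact lt_irrefl x (Finset.mem_filter.1 (h hx)).2

theorem card_filter_lt_of_mem_right (hBX : ∀ b ∈ B, ∀ x ∈ X, b < x) {x : ℕ} (hx : x ∈ X) :
    ((B ∪ X).filter (fun y => y < x)).card = (X.filter (fun y => y < x)).card + B.card := by
  have hd : Disjoint B X := Finset.disjoint_left.2 fun b hb hb' => lt_irrefl b (hBX b hb b hb')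
  rw [Finset.filter_union, Finset.card_union_of_disjoint (Finset.disjoint_filter_filter hd),
    Finset.filter_true_of_mem fun b hb => hBX b hb x hx, add_comm]

theorem block_union_zero (hl : 0 < l) (hB : B.card = l) (hBX : ∀ b ∈ B, ∀ x ∈ X, b < x) :
    block l (B ∪ X) 0 = B := by
  ext x
  rw [block, Finset.mem_filter, Finset.mem_union]
  constructor
  · rintro ⟨hx | hx, h⟩
    · exact hx
    · rw [card_filter_lt_of_mem_right hBX hx, hB, Nat.add_div_right _ hl] at h
      exact absurd h (Nat.succ_ne_zero _)
  · intro hx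
    exact ⟨Or.inl hx, Nat.div_eq_of_lt (hB ▸ card_filter_lt_of_mem_left hBX hx)⟩

theorem block_union_succ (hl : 0 < l) (hB : B.card = l) (hBX : ∀ b ∈ B, ∀ x ∈ X, b < x) (i : ℕ) :
    block l (B ∪ X) (i + 1) = block l X i := by
  ext x
  rw [block, block, Finset.mem_filter, Finset.mem_union, Finset.mem_filter]
  constructor
  · rintro ⟨hx | hx, h⟩
    · rw [Nat.div_eq_of_lt (hB ▸ card_filter_lt_of_mem_left hBX hx)] at h
      omega
    · rw [card_filter_lt_of_mem_right hBX hx, hB, Nat.add_div_right _ hl] at h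
      exact ⟨hx, Nat.succ_injective h⟩
  · rintro ⟨hx, h⟩
    refine ⟨Or.inr hx, ?_⟩
    rw [card_filter_lt_of_mem_right hBX hx, hB, Nat.add_div_right _ hl, h]

end Blocks

/-- Induction on the list, splitting the subsets by whether they contain the head, exactly as the
scan does. The order of the list makes scanned blocks agree with `block`. -/
theorem blockWeight_eq_sum_powerset {p : ℝ} {l : ℕ} {φ : Finset ℕ → ℂ} (L : List ℕ) :
    ∀ (B : Finset ℕ) (j : ℕ), L.Pairwise (· < ·) → (∀ b ∈ B, ∀ x ∈ L, b < x) → B.card < l →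
      blockWeight p l φ L B j = ∑ X ∈ L.toFinset.powerset, if X.card + B.card = j * l then
        (p : ℂ) ^ X.card * (1 - p) ^ (L.length - X.card) *
          ∏ i ∈ Finset.range j, φ (block l (B ∪ X) i) else 0 := by
  induction L with
  | nil =>
    intro B j _ _ hB
    rw [blockWeight]
    simp only [List.toFinset_nil, Finset.powerset_empty, Finset.sum_singleton, Finset.card_empty,
      zero_add, pow_zero, List.length_nil, one_mul, Finset.union_empty]
    rcases j with _ | j
    · simp
    · rw [if_neg (by omega), if_neg (by rw [add_one_mul]; omega)]
  | cons x L ih =>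
    intro B j hs hBL hB
    have hxL : ∀ y ∈ L, x < y := (List.pairwise_cons.1 hs).1
    have hs' := (List.pairwise_cons.1 hs).2
    have hxn : x ∉ L.toFinset := fun h => lt_irrefl x (hxL x (List.mem_toFinset.1 h))
    have hxB : x ∉ B := fun h => lt_irrefl x (hBL x h x (by simp))
    have hBL' : ∀ b ∈ B, ∀ y ∈ L, b < y := fun b hb y hy => hBL b hb y (by simp [hy])
    have hBx : ∀ b ∈ insert x B, ∀ y ∈ L, b < y := by
      intro b hb y hy
      rcases Finset.mem_insert.1 hb with rfl | hb
      · exact hxL y hy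
      · exact hBL' b hb y hy
    have hcB : (insert x B).card = B.card + 1 := Finset.card_insert_of_notMem hxB
    have hXL : ∀ X ∈ L.toFinset.powerset, X.card ≤ L.length ∧ x ∉ X ∧
        ∀ b ∈ insert x B, ∀ y ∈ X, b < y := fun X hX =>
      have hX' := Finset.mem_powerset.1 hX
      ⟨(Finset.card_le_card hX').trans L.toFinset_card_le, fun h => hxn (hX' h),
        fun b hb y hy => hBx b hb y (List.mem_toFinset.1 (hX' hy))⟩
    rw [List.toFinset_cons, Finset.sum_powerset_insert hxn]
    have hdrop : ∑ X ∈ L.toFinset.powerset, (if X.card + B.card = j * l then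
        (p : ℂ) ^ X.card * (1 - p) ^ ((x :: L).length - X.card) *
          ∏ i ∈ Finset.range j, φ (block l (B ∪ X) i) else 0) =
        (1 - p) * blockWeight p l φ L B j := by
      rw [ih B j hs' hBL' hB, Finset.mul_sum]
      refine Finset.sum_congr rfl fun X hX => ?_
      rw [mul_ite, mul_zero, List.length_cons, Nat.sub_add_comm (hXL X hX).1, pow_succ]
      split_ifs
      · ring
      · rfl
    rw [hdrop]
    rcases j with _ | j
    · rw [blockWeight, Finset.sum_eq_zero, add_zero]
      intro X hX
      rw [if_neg]
      rw [Finset.card_insert_of_notMem (hXL X hX).2.1]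
      omega
    · rw [blockWeight]
      congr 1
      have hterm : ∀ X ∈ L.toFinset.powerset,
          (if (insert x X).card + B.card = (j + 1) * l then
            (p : ℂ) ^ (insert x X).card * (1 - p) ^ ((x :: L).length - (insert x X).card) *
              ∏ i ∈ Finset.range (j + 1), φ (block l (B ∪ insert x X) i) else 0) =
          p * if X.card + (insert x B).card = (j + 1) * l then
            (p : ℂ) ^ X.card * (1 - p) ^ (L.length - X.card) *
              ∏ i ∈ Finset.range (j + 1), φ (block l (insert x B ∪ X) i) else 0 := by
        intro X hX
        have hu : B ∪ insert x X = insert x B ∪ X := by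
          ext y; simp
        rw [Finset.card_insert_of_notMem (hXL X hX).2.1, hcB, hu, List.length_cons,
          Nat.add_sub_add_right, show X.card + 1 + B.card = X.card + (B.card + 1) by ring,
          mul_ite, mul_zero]
        split_ifs
        · rw [pow_succ]; ring
        · rfl
      rw [Finset.sum_congr rfl hterm, ← Finset.mul_sum]
      congr 1
      -- A full block becomes block 0 and shifts the other indices by one.
      split_ifs with hl
      · have hl0 : 0 < l := by omega
        rw [ih ∅ j hs' (by simp) (by simpa using hl0), Finset.mul_sum]
        refine Finset.sum_congr rfl fun X hX => ?_
        rw [mul_ite, mul_zero, hl, Finset.card_empty, add_zero, Finset.empty_union, add_one_mul]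
        simp only [Nat.add_right_cancel_iff]
        split_ifs
        · rw [Finset.prod_range_succ', block_union_zero hl0 hl (hXL X hX).2.2]
          simp only [block_union_succ hl0 hl (hXL X hX).2.2]
          ring
        · rfl
      · exact ih (insert x B) (j + 1) hs' hBx (by omega)

theorem blockWeight_sort_eq {p : ℝ} {l : ℕ} {φ : Finset ℕ → ℂ} (hl : 0 < l) (S : Finset ℕ)
    (j : ℕ) : blockWeight p l φ S.sort ∅ j = (p : ℂ) ^ (j * l) * (1 - p) ^ (S.card - j * l) *
      ∑ X ∈ S.powersetCard (j * l), ∏ i ∈ Finset.range j, φ (block l X i) := by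
  have h := blockWeight_eq_sum_powerset (p := p) (φ := φ) S.sort ∅ j S.sortedLT_sort.pairwise
    (by simp) (by simpa using hl)
  rw [h, Finset.sort_toFinset, ← Finset.sum_filter, Finset.mul_sum]
  simp only [Finset.card_empty, add_zero, Finset.empty_union, Finset.length_sort]
  rw [← Finset.powersetCard_eq_filter]
  refine Finset.sum_congr rfl fun X hX => ?_
  rw [(Finset.mem_powersetCard.1 hX).2]

/-! ### Averaging over subsets, and the binomial mode -/

/-- Double counting: `X` survives the deletion of `x` exactly for the `x` in `S \ X`. -/
theorem sum_sum_powersetCard_erase (F : Finset ℕ → ℂ) (S : Finset ℕ) (k : ℕ) :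
    ∑ x ∈ S, ∑ X ∈ (S.erase x).powersetCard k, F X =
      ((S.card - k : ℕ) : ℂ) * ∑ X ∈ S.powersetCard k, F X := by
  rw [Finset.sum_comm' (t' := S.powersetCard k) (s' := fun X => S \ X)]
  · rw [Finset.mul_sum]
    refine Finset.sum_congr rfl fun X hX => ?_
    obtain ⟨hXS, hXk⟩ := Finset.mem_powersetCard.1 hX
    rw [Finset.sum_const, Finset.card_sdiff_of_subset hXS, hXk, nsmul_eq_mul]
  · intro x X
    simp only [Finset.mem_powersetCard, Finset.subset_erase, Finset.mem_sdiff]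
    tauto

/-- A bound for the averages over the `n`-subsets passes to larger sets. -/
theorem norm_sum_powersetCard_le {F : Finset ℕ → ℂ} {S₀ : Finset ℕ} {k n : ℕ} {ρ : ℝ}
    (hkn : k ≤ n) (h : ∀ Z ⊆ S₀, Z.card = n →
      ‖∑ X ∈ Z.powersetCard k, F X‖ ≤ ρ * (n.choose k : ℝ)) (d : ℕ) :
    ∀ S ⊆ S₀, S.card = n + d →
      ‖∑ X ∈ S.powersetCard k, F X‖ ≤ ρ * (S.card.choose k : ℝ) := by
  induction d with
  | zero => intro S hS hc; rw [hc]; exact h S hS hc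
  | succ d ih =>
    intro S hS hc
    have h1 : ‖∑ x ∈ S, ∑ X ∈ (S.erase x).powersetCard k, F X‖ ≤
        S.card * (ρ * ((n + d).choose k : ℝ)) := by
      rw [← nsmul_eq_mul]
      refine norm_sum_le_of_le _ (fun x hx => ?_) |>.trans_eq (Finset.sum_const _)
      have hce : (S.erase x).card = n + d := by rw [Finset.card_erase_of_mem hx]; omega
      rw [← hce]
      exact ih _ ((Finset.erase_subset x S).trans hS) hce
    rw [sum_sum_powersetCard_erase, norm_mul, Complex.norm_natCast] at h1
    have h2 : (((n + d).choose k : ℕ) : ℝ) * S.card = (S.card.choose k : ℝ) * (S.card - k : ℕ) := by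
      rw [hc]; exact_mod_cast Nat.choose_mul_succ_eq (n + d) k
    have h3 : (0 : ℝ) < (S.card - k : ℕ) := by exact_mod_cast (by omega : 0 < S.card - k)
    refine le_of_mul_le_mul_left (h1.trans_eq ?_) h3
    linear_combination ρ * h2

/-- The most likely value of a binomial variable with `m * (l + 1)` trials of success probability
`l / (l + 1)` is `m * l`. -/
theorem one_le_mul_binomial (l m : ℕ) : (1 : ℝ) ≤ (m * (l + 1) + 1) *
    (((m * (l + 1)).choose (m * l) : ℝ) * ((l : ℝ) / (l + 1)) ^ (m * l) *
      (1 - (l : ℝ) / (l + 1)) ^ m) := by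
  set n := m * (l + 1) with hn
  have hl : (0 : ℝ) < l + 1 := by positivity
  set q : ℝ := 1 - (l : ℝ) / (l + 1) with hq
  have hq' : q = 1 / (l + 1) := by rw [hq]; field_simp; ring
  have hpq : (l : ℝ) / (l + 1) = l * q := by rw [hq']; ring
  have hq0 : 0 ≤ q := by rw [hq']; positivity
  set p : ℝ := (l : ℝ) / (l + 1) with hp
  have hp0 : 0 ≤ p := by positivity
  set b : ℕ → ℝ := fun i => p ^ i * q ^ (n - i) * (n.choose i : ℝ) with hb
  have hb0 : ∀ i, 0 ≤ b i := fun i => by simp only [hb]; positivity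
  have hsum : ∑ i ∈ Finset.range (n + 1), b i = 1 := by
    rw [← add_pow, hq, add_sub_cancel, one_pow]
  -- The ratio of consecutive binomial terms, the odds `p / q` being `l`. It shows that the terms
  -- rise up to `m * l` and do not increase afterwards.
  have hrec : ∀ i < n, b (i + 1) * (i + 1) = b i * ((n - i : ℕ) * l) := by
    intro i hi
    have h1 : (n.choose (i + 1) : ℝ) * (i + 1) = n.choose i * (n - i : ℕ) := by
      exact_mod_cast Nat.choose_succ_right_eq n i
    have h2 : n - i = n - (i + 1) + 1 := by omega
    have h3 : q ^ (n - i) = q ^ (n - (i + 1)) * q := by rw [h2, pow_succ]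
    simp only [hb]
    rw [h3, pow_succ]
    linear_combination p ^ i * p * q ^ (n - (i + 1)) * h1 +
      p ^ i * q ^ (n - (i + 1)) * (n.choose i * (n - i : ℕ)) * hpq
  have hnm : n = m * l + m := by rw [hn]; ring
  have hup : ∀ d ≤ m * l, b (m * l - d) ≤ b (m * l) := by
    intro d
    induction d with
    | zero => intro _; simp
    | succ d ih =>
      intro hd
      refine le_trans ?_ (ih (by omega))
      obtain ⟨i, hi⟩ : ∃ i, m * l = i + (d + 1) := ⟨m * l - (d + 1), by omega⟩
      have e1 : m * l - (d + 1) = i := by omega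
      have e2 : m * l - d = i + 1 := by omega
      rw [e1, e2]
      have h1 := hrec i (by omega)
      have h2 : i + 1 ≤ (n - i) * l :=
        calc i + 1 ≤ m * l := by omega
          _ ≤ (n - i) * l := Nat.mul_le_mul_right l (by omega)
      have h3 : ((i : ℝ) + 1) ≤ (n - i : ℕ) * l := by exact_mod_cast h2
      have h4 : b i * (i + 1) ≤ b (i + 1) * (i + 1) := by
        rw [h1]; exact mul_le_mul_of_nonneg_left h3 (hb0 i)
      exact le_of_mul_le_mul_right h4 (by positivity)
  have hdown : ∀ d, m * l + d ≤ n → b (m * l + d) ≤ b (m * l) := by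
    intro d
    induction d with
    | zero => intro _; simp
    | succ d ih =>
      intro hd
      refine le_trans ?_ (ih (by omega))
      have h1 := hrec (m * l + d) (by omega)
      have h2 : (n - (m * l + d)) * l ≤ m * l + d + 1 :=
        calc (n - (m * l + d)) * l ≤ m * l := Nat.mul_le_mul_right l (by omega)
          _ ≤ m * l + d + 1 := by omega
      have h3 : ((n - (m * l + d) : ℕ) : ℝ) * l ≤ (m * l + d : ℕ) + 1 := by exact_mod_cast h2
      have h4 : b (m * l + d + 1) * ((m * l + d : ℕ) + 1) ≤
          b (m * l + d) * ((m * l + d : ℕ) + 1) := by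
        rw [h1]; exact mul_le_mul_of_nonneg_left h3 (hb0 _)
      exact le_of_mul_le_mul_right h4 (by positivity)
  have hmax : ∀ i ∈ Finset.range (n + 1), b i ≤ b (m * l) := by
    intro i hi
    rw [Finset.mem_range] at hi
    rcases le_total i (m * l) with h | h
    · have := hup (m * l - i) (by omega)
      rwa [Nat.sub_sub_self h] at this
    · have := hdown (i - m * l) (by omega)
      rwa [Nat.add_sub_cancel' h] at this
  have h1 := Finset.sum_le_card_nsmul _ _ _ hmax
  rw [hsum, Finset.card_range, nsmul_eq_mul] at h1
  refine h1.trans_eq ?_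
  simp only [hb]
  rw [show n - m * l = m by omega, hn]
  push_cast
  ring

/-! ### Characters of `ZMod c` -/

/-- Distinct unit vectors satisfy the strict triangle inequality, and there are finitely many pairs.
The value 1 on the diagonal and the minimum with 1 only secure `0 < η ≤ 1`. -/
theorem exists_norm_stdAddChar_add_le (c : ℕ) [NeZero c] : ∃ η : ℝ, 0 < η ∧ η ≤ 1 ∧
    ∀ u v : ZMod c, u ≠ v → ‖ZMod.stdAddChar u + ZMod.stdAddChar v‖ ≤ 2 - η := by
  classical
  let f : ZMod c × ZMod c → ℝ := fun z => if z.1 = z.2 then 1 else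
    min 1 (2 - ‖ZMod.stdAddChar z.1 + ZMod.stdAddChar z.2‖)
  obtain ⟨z, hz⟩ := Finite.exists_min f
  have hpos : ∀ z, 0 < f z := by
    rintro ⟨u, v⟩
    simp only [f]
    split_ifs with h
    · exact one_pos
    · have hn : ∀ w : ZMod c, ‖ZMod.stdAddChar w‖ = 1 := fun w => AddChar.norm_apply _ _
      have h1 : ‖ZMod.stdAddChar u + ZMod.stdAddChar v‖ < 2 := by
        refine lt_of_le_of_ne ((norm_add_le _ _).trans_eq (by rw [hn, hn]; norm_num)) fun he => ?_
        exact h (ZMod.injective_stdAddChar (eq_of_norm_eq_of_norm_add_eq (by rw [hn, hn])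
          (by rw [he, hn, hn]; norm_num)))
      exact lt_min one_pos (by linarith)
  refine ⟨f z, hpos z, ?_, fun u v huv => ?_⟩
  · exact (hz (0, 0)).trans (by simp [f])
  · have h := hz (u, v)
    simp only [f, if_neg huv] at h ⊢
    have := h.trans (min_le_right _ _)
    linarith

/-- Colours differ by 1 or 2 up to sign, and for odd `c` neither `t` nor `2 * t` vanishes. For even
`c`, the colours 0 and 2 would collide at `t = c / 2`. -/
theorem natCast_mul_ne {c : ℕ} (hc : Odd c) {t : ZMod c} (ht : t ≠ 0) {a b : ℕ} (ha : a < 3)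
    (hb : b < 3) (hab : a ≠ b) : t * (a : ZMod c) ≠ t * (b : ZMod c) := by
  have h2 : t * 2 ≠ 0 := by
    intro h
    obtain ⟨d, rfl⟩ := hc
    have h1 : ((2 * d + 1 : ℕ) : ZMod (2 * d + 1)) = 0 := ZMod.natCast_self _
    push_cast at h1
    apply ht
    linear_combination t * h1 - d * h
  intro h
  interval_cases a <;> interval_cases b <;> first | exact hab rfl | skip
  all_goals push_cast at h
  · exact ht (by linear_combination -h)
  · exact h2 (by linear_combination -h)
  · exact ht (by linear_combination h)
  · exact ht (by linear_combination -h)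
  · exact h2 (by linear_combination h)
  · exact ht (by linear_combination h)

/-- Small nontrivial Fourier coefficients give small discrepancy. -/
theorem disc_le_of_norm_sum_le {α : Type*} {c : ℕ} [NeZero c] (γ : α → ZMod c) (A : Finset α)
    {ρ : ℝ} (hc : 1 < c) (hA : A.Nonempty)
    (h : ∀ t : ZMod c, t ≠ 0 → ‖∑ X ∈ A, ZMod.stdAddChar (t * γ X)‖ ≤ ρ * (A.card : ℝ)) :
    disc γ A ≤ ρ := by
  have hA0 : (0 : ℝ) < A.card := by exact_mod_cast hA.card_pos
  have hc0 : (0 : ℝ) < c := by exact_mod_cast NeZero.pos c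
  refine ciSup_le fun i => ?_
  rw [ZMod.card]
  have hind : ∀ X, ∑ t : ZMod c, ZMod.stdAddChar (t * (γ X - i)) =
      if γ X = i then (c : ℂ) else 0 := by
    intro X
    rw [AddChar.sum_mulShift _ (ZMod.isPrimitive_stdAddChar c), ZMod.card]
    simp only [sub_eq_zero]
    split_ifs <;> simp
  have h1 : (c : ℂ) * ((A.filter (fun X => γ X = i)).card : ℂ) =
      ∑ t : ZMod c, ZMod.stdAddChar (-(t * i)) * ∑ X ∈ A, ZMod.stdAddChar (t * γ X) := by
    simp only [Finset.mul_sum, ← AddChar.map_add_eq_mul]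
    rw [Finset.sum_comm]
    have : ∀ X (t : ZMod c), -(t * i) + t * γ X = t * (γ X - i) := fun X t => by ring
    simp only [this, hind]
    rw [← Finset.sum_filter, Finset.sum_const, nsmul_eq_mul, mul_comm]
  rw [← Finset.add_sum_erase _ _ (Finset.mem_univ 0)] at h1
  simp only [zero_mul, neg_zero, AddChar.map_zero_eq_one, Finset.sum_const, nsmul_eq_mul, mul_one,
    one_mul] at h1
  have h2 : ‖∑ t ∈ Finset.univ.erase (0 : ZMod c),
      ZMod.stdAddChar (-(t * i)) * ∑ X ∈ A, ZMod.stdAddChar (t * γ X)‖ ≤ c * (ρ * A.card) := by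
    have h3 : ‖∑ t ∈ Finset.univ.erase (0 : ZMod c),
        ZMod.stdAddChar (-(t * i)) * ∑ X ∈ A, ZMod.stdAddChar (t * γ X)‖ ≤
        ∑ t ∈ Finset.univ.erase (0 : ZMod c), ρ * A.card := by
      refine norm_sum_le_of_le _ fun t ht => ?_
      rw [norm_mul, AddChar.norm_apply, one_mul]
      exact h t (Finset.ne_of_mem_erase ht)
    rw [Finset.sum_const, Finset.card_erase_of_mem (Finset.mem_univ _), Finset.card_univ,
      ZMod.card, nsmul_eq_mul] at h3
    refine h3.trans ?_
    -- Needed for `1 ≠ 0`: the hypothesis at `t = 1` yields `0 ≤ ρ * A.card`.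
    have : Fact (1 < c) := ⟨hc⟩
    have hρ := (norm_nonneg _).trans (h 1 one_ne_zero)
    refine mul_le_mul_of_nonneg_right ?_ hρ
    exact_mod_cast Nat.sub_le c 1
  set a : ℝ := ((A.filter (fun X => γ X = i)).card : ℝ) with ha
  have h3 : |c * a - A.card| ≤ c * (ρ * A.card) := by
    rw [← sub_eq_iff_eq_add'] at h1
    rw [← h1] at h2
    rw [← Real.norm_eq_abs, ← Complex.norm_real]
    simpa [ha] using h2
  have h4 : a / A.card - 1 / c = (c * a - A.card) / (c * A.card) := by
    field_simp
  rw [h4, abs_div, abs_of_pos (mul_pos hc0 hA0), div_le_iff₀ (mul_pos hc0 hA0)]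
  linarith

/-! ### Numerical estimates -/

theorem one_div_le_mul_pow {l : ℕ} (hl : 0 < l) :
    1 / (3 * ((l : ℝ) + 1)) ≤ (1 - (l : ℝ) / (l + 1)) * ((l : ℝ) / (l + 1)) ^ l := by
  have hl0 : (0 : ℝ) < l := by exact_mod_cast hl
  have h1 : (1 + 1 / (l : ℝ)) ^ l ≤ 3 := by
    have h2 : 1 + 1 / (l : ℝ) ≤ Real.exp (1 / l) := by
      rw [add_comm]; exact Real.add_one_le_exp _
    calc (1 + 1 / (l : ℝ)) ^ l ≤ Real.exp (1 / l) ^ l := by gcongr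
      _ = Real.exp 1 := by rw [← Real.exp_nat_mul, mul_one_div_cancel hl0.ne']
      _ ≤ 3 := by have := Real.exp_one_lt_d9; linarith
  have h2 : (l : ℝ) / (l + 1) = (1 + 1 / (l : ℝ))⁻¹ := by field_simp
  have h3 : 1 - (l : ℝ) / (l + 1) = 1 / (l + 1) := by field_simp; ring
  rw [h3, h2, inv_pow, one_div, mul_inv, mul_comm, one_div]
  gcongr

theorem error_le_exp {η δ : ℝ} (hη0 : 0 < η) (hη1 : η ≤ 1) (hδ : 0 < δ) {l m : ℕ} (hl1 : 1 ≤ l)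
    (hl : 15552 / η ^ 2 ≤ l) (hm : (l : ℝ) ^ (6 + 3 * δ) ≤ m) :
    (m * ((l : ℝ) + 1) + 1) *
      ((1 - η / (9 * ((l : ℝ) + 1))) ^ m / (1 - η / (9 * ((l : ℝ) + 1)))) ≤
      Real.exp (-(η / 36) * (l : ℝ) ^ δ) := by
  have hlr : (1 : ℝ) ≤ l := by exact_mod_cast hl1
  have hl0 : (0 : ℝ) < l := by linarith
  set g := η / (9 * ((l : ℝ) + 1)) with hg
  have hg1 : g ≤ 1 / 2 := by
    rw [hg, div_le_iff₀ (by positivity)]; linarith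
  have hgη : η / (18 * l) ≤ g := by
    rw [hg]; gcongr η / ?_; linarith
  have hm6 : (l : ℝ) ^ 6 ≤ m := by
    refine le_trans ?_ hm
    rw [← Real.rpow_natCast]
    exact Real.rpow_le_rpow_of_exponent_le hlr (by push_cast; linarith)
  have hm1 : (1 : ℝ) ≤ m := (one_le_pow₀ hlr).trans hm6
  have hmδ : (l : ℝ) * (l : ℝ) ^ δ ≤ m := by
    refine le_trans ?_ hm
    rw [← Real.rpow_one_add' hl0.le (by positivity)]
    exact Real.rpow_le_rpow_of_exponent_le hlr (by linarith)
  -- The decay is at least `exp (-2y)`: one `exp (-y)` absorbs the polynomial factor, the other is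
  -- the final bound.
  set y := η * m / (36 * l) with hy
  have hy0 : 0 ≤ y := by positivity
  have hgm : 2 * y ≤ m * g := by
    calc 2 * y = m * (η / (18 * l)) := by rw [hy]; field_simp; ring
      _ ≤ m * g := by gcongr
  have hyδ : η / 36 * (l : ℝ) ^ δ ≤ y := by
    rw [hy, le_div_iff₀ (by positivity)]
    calc η / 36 * (l : ℝ) ^ δ * (36 * l) = η * (l * (l : ℝ) ^ δ) := by ring
      _ ≤ η * m := by gcongr
  have hηl : 15552 ≤ η ^ 2 * l := by
    rw [div_le_iff₀ (by positivity)] at hl; linarith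
  have hηm : 15552 * (l : ℝ) ^ 3 ≤ η ^ 2 * m := by
    calc 15552 * (l : ℝ) ^ 3 ≤ η ^ 2 * l * (l : ℝ) ^ 3 := by gcongr
      _ ≤ η ^ 2 * l * (l : ℝ) ^ 5 := by gcongr; norm_num
      _ = η ^ 2 * (l : ℝ) ^ 6 := by ring
      _ ≤ η ^ 2 * m := by gcongr
  have hpoly : 2 * (m * ((l : ℝ) + 1) + 1) ≤ Real.exp y := by
    have h1 := Real.quadratic_le_exp_of_nonneg hy0
    -- The left side of `hpoly` is at most `6 * l * m`. Comparing this with `y ^ 2 / 2` requires `η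
    -- ^ 2 * m ≥ 15552 * l ^ 3`, where `15552 = 6 * 2 * 36 ^ 2`.
    have h2 : 6 * (l * m) ≤ y ^ 2 / 2 := by
      have h3 : y ^ 2 / 2 = η ^ 2 * m * m / (2592 * l ^ 2) := by rw [hy]; field_simp; ring
      rw [h3, le_div_iff₀ (by positivity)]
      calc 6 * (l * m) * (2592 * (l : ℝ) ^ 2) = 15552 * (l : ℝ) ^ 3 * m := by ring
        _ ≤ η ^ 2 * m * m := by gcongr
    have h4 : (m : ℝ) ≤ l * m := le_mul_of_one_le_left (by linarith) hlr
    linarith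
  have hpow : (1 - g) ^ m / (1 - g) ≤ 2 * Real.exp (-(2 * y)) := by
    rw [div_le_iff₀ (by linarith)]
    have h1 : (1 - g) ^ m ≤ Real.exp (-(2 * y)) := by
      calc (1 - g) ^ m ≤ Real.exp (-g) ^ m := by
            gcongr
            · linarith
            · exact Real.one_sub_le_exp_neg g
        _ = Real.exp (m * -g) := by rw [← Real.exp_nat_mul]
        _ ≤ Real.exp (-(2 * y)) := Real.exp_le_exp.2 (by linarith)
    have h2 := Real.exp_pos (-(2 * y))
    nlinarith
  calc _ ≤ (m * ((l : ℝ) + 1) + 1) * (2 * Real.exp (-(2 * y))) := by gcongr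
    _ = 2 * (m * ((l : ℝ) + 1) + 1) * Real.exp (-(2 * y)) := by ring
    _ ≤ Real.exp y * Real.exp (-(2 * y)) := by gcongr
    _ = Real.exp (-y) := by rw [← Real.exp_add]; congr 1; ring
    _ ≤ _ := Real.exp_le_exp.2 (by linarith)

/-! ### Combining the colouring with the scan estimate -/

theorem shiftColor_insert_ne {N l : ℕ} (hl : 5 ≤ l) (hN : N ≤ 4 * tw (l - 3) 2) {x y : ℕ}
    {D : Finset ℕ} (hD : D.card + 1 = l) (hxD : ∀ d ∈ D, x < d) (hDy : ∀ d ∈ D, d < y)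
    (hx : x ∈ Finset.Icc 1 N) (hy : y ∈ Finset.Icc 1 N) (hDN : D ⊆ Finset.Icc 1 N) :
    shiftColor l (insert x D) ≠ shiftColor l (insert y D) := by
  obtain ⟨d, hd⟩ : D.Nonempty := Finset.card_pos.1 (by omega)
  have hxy : x < y := (hxD d hd).trans (hDy d hd)
  have hxD' : x ∉ D := fun h => lt_irrefl x (hxD x h)
  have hyD' : y ∉ D := fun h => lt_irrefl y (hDy y h)
  have hM : dropMax (insert x (insert y D)) = insert x D := by
    ext z
    simp only [mem_dropMax, Finset.mem_insert, exists_eq_or_imp]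
    constructor
    · rintro ⟨rfl | rfl | hz, h⟩
      · exact Or.inl rfl
      · exfalso
        rcases h with h | h | ⟨w, hw, h⟩
        · omega
        · omega
        · have := hDy w hw; omega
      · exact Or.inr hz
    · rintro (rfl | hz)
      · exact ⟨Or.inl rfl, Or.inr (Or.inl hxy)⟩
      · exact ⟨Or.inr (Or.inr hz), Or.inr (Or.inl (hDy z hz))⟩
  have hm : dropMin (insert x (insert y D)) = insert y D := by
    ext z
    simp only [mem_dropMin, Finset.mem_insert, exists_eq_or_imp]
    constructor
    · rintro ⟨rfl | rfl | hz, h⟩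
      · exfalso
        rcases h with h | h | ⟨w, hw, h⟩
        · omega
        · omega
        · have := hxD w hw; omega
      · exact Or.inl rfl
      · exact Or.inr hz
    · rintro (rfl | hz)
      · exact ⟨Or.inr (Or.inl rfl), Or.inl hxy⟩
      · exact ⟨Or.inr (Or.inr hz), Or.inl (hxD z hz)⟩
  have h := shiftColor_ne hl hN (D := insert x (insert y D))
    (Finset.insert_subset hx (Finset.insert_subset hy hDN)) (by
      rw [Finset.card_insert_of_notMem, Finset.card_insert_of_notMem hyD', hD]
      simp only [Finset.mem_insert, not_or]
      exact ⟨hxy.ne, hxD'⟩)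
  rwa [hM, hm] at h

theorem addChar_map_sum {A M ι : Type*} [AddCommMonoid A] [CommMonoid M] (ψ : AddChar A M)
    (s : Finset ι) (f : ι → A) : ψ (∑ i ∈ s, f i) = ∏ i ∈ s, ψ (f i) := by
  induction s using Finset.cons_induction with
  | empty => simp
  | cons a s ha ih => rw [Finset.sum_cons, Finset.prod_cons, AddChar.map_add_eq_mul, ih]

/-- The nontrivial Fourier coefficients of the block sum colouring on the sets of
`m * (l + 1)` elements. -/
theorem norm_sum_stdAddChar_le {c N l m : ℕ} [NeZero c] (hc : Odd c) (hl : 5 ≤ l)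
    (hN : N ≤ 4 * tw (l - 3) 2) {η : ℝ} (hη0 : 0 < η) (hη1 : η ≤ 1)
    (hη : ∀ u v : ZMod c, u ≠ v → ‖ZMod.stdAddChar u + ZMod.stdAddChar v‖ ≤ 2 - η)
    {t : ZMod c} (ht : t ≠ 0) {Z : Finset ℕ} (hZ : Z ⊆ Finset.Icc 1 N)
    (hcard : Z.card = m * (l + 1)) :
    ‖∑ X ∈ Z.powersetCard (m * l), ZMod.stdAddChar (t * blockSumColor c (m * l) l X)‖ ≤
      (m * ((l : ℝ) + 1) + 1) *
        ((1 - η / (9 * ((l : ℝ) + 1))) ^ m / (1 - η / (9 * ((l : ℝ) + 1)))) *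
        ((m * (l + 1)).choose (m * l) : ℝ) := by
  have hl0 : (0 : ℝ) < l := by exact_mod_cast (by omega : 0 < l)
  set g := η / (9 * ((l : ℝ) + 1)) with hg
  have hg0 : 0 ≤ g := by positivity
  have hg1 : g ≤ 1 / 2 := by
    rw [hg, div_le_iff₀ (by positivity)]; linarith
  set p : ℝ := (l : ℝ) / (l + 1) with hp
  have hp0 : 0 ≤ p := by positivity
  have hp1 : p ≤ 1 := by rw [hp, div_le_one (by positivity)]; linarith
  -- The 9 in `g` is 3 from `(1 + 1 / l) ^ l ≤ 3` times the 3 of the gain-loss balance.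
  have hgη : 3 * g ≤ (1 - p) * p ^ l * η :=
    calc 3 * g = 1 / (3 * ((l : ℝ) + 1)) * η := by rw [hg]; field_simp; ring
      _ ≤ _ := mul_le_mul_of_nonneg_right (one_div_le_mul_pow (by omega)) hη0.le
  let φ : Finset ℕ → ℂ := fun B => ZMod.stdAddChar (t * (shiftColor l B : ZMod c))
  have hφ : ∀ B, ‖φ B‖ ≤ 1 := fun B => (AddChar.norm_apply _ _).le
  have hpair : ∀ x D y L', x :: (D ++ y :: L') <:+ Z.sort → D.length + 1 = l →
      ‖φ (insert x D.toFinset) + φ (insert y D.toFinset)‖ ≤ 2 - η := by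
    intro x D y L' hs hD
    have hpw : (x :: (D ++ y :: L')).Pairwise (· < ·) :=
      Z.sortedLT_sort.pairwise.sublist hs.sublist
    have hmem : ∀ z ∈ x :: (D ++ y :: L'), z ∈ Finset.Icc 1 N := fun z hz =>
      hZ ((Finset.mem_sort _).1 (hs.subset hz))
    simp only [List.pairwise_cons, List.pairwise_append, List.mem_append, List.mem_cons] at hpw
    obtain ⟨hx, hDp, -, hDy⟩ := hpw
    have hcD : D.toFinset.card + 1 = l := by
      rw [List.toFinset_card_of_nodup (hDp.imp fun h => h.ne), hD]
    have hxD : ∀ d ∈ D.toFinset, x < d := fun d hd => hx d (Or.inl (List.mem_toFinset.1 hd))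
    have hDy' : ∀ d ∈ D.toFinset, d < y := fun d hd => hDy d (List.mem_toFinset.1 hd) y (Or.inl rfl)
    have hxN := hmem x (by simp)
    have hyN := hmem y (by simp)
    have hDN : D.toFinset ⊆ Finset.Icc 1 N := fun d hd =>
      hmem d (by simp [List.mem_toFinset.1 hd])
    refine hη _ _ (natCast_mul_ne hc ht ?_ ?_ ?_)
    · refine shiftColor_lt hl hN (Finset.insert_subset hxN hDN) ?_
      rw [Finset.card_insert_of_notMem fun h => lt_irrefl x (hxD x h), hcD]
    · refine shiftColor_lt hl hN (Finset.insert_subset hyN hDN) ?_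
      rw [Finset.card_insert_of_notMem fun h => lt_irrefl y (hDy' y h), hcD]
    · exact shiftColor_insert_ne hl hN hcD hxD hDy' hxN hyN hDN
  have hw := (norm_blockWeight_le hp0 hp1 hφ (by omega) hg0 hg1 hgη (Z.sort_nodup _) hpair m).1
    Z.sort List.suffix_rfl
  rw [blockWeight_sort_eq (by omega), hcard] at hw
  have hsum : ∀ X, ∏ i ∈ Finset.range m, φ (block l X i) =
      ZMod.stdAddChar (t * blockSumColor c (m * l) l X) := by
    intro X
    rw [blockSumColor, Nat.mul_div_cancel m (by omega), Finset.mul_sum, addChar_map_sum]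
  simp only [hsum] at hw
  set T := ∑ X ∈ Z.powersetCard (m * l), ZMod.stdAddChar (t * blockSumColor c (m * l) l X)
  have h1p : ‖(1 - p : ℂ)‖ = 1 - p := by
    rw [← Complex.ofReal_one, ← Complex.ofReal_sub, Complex.norm_real, Real.norm_of_nonneg]
    linarith
  rw [norm_mul, norm_mul, norm_pow, norm_pow, h1p, Complex.norm_real, Real.norm_of_nonneg hp0,
    show m * (l + 1) - m * l = m by rw [mul_add_one]; omega] at hw
  have hb := one_le_mul_binomial l m
  rw [← hp] at hb
  set C : ℝ := ((m * (l + 1)).choose (m * l) : ℝ)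
  calc ‖T‖ = 1 * ‖T‖ := (one_mul _).symm
    -- Undoes the conditioning on the size `m * l`, whose probability is at least `1 / (m * (l + 1)
    -- + 1)`.
    _ ≤ ((m * (l + 1) + 1) * (C * p ^ (m * l) * (1 - p) ^ m)) * ‖T‖ := by gcongr
    _ = (m * (l + 1) + 1) * C * (p ^ (m * l) * (1 - p) ^ m * ‖T‖) := by ring
    _ ≤ (m * (l + 1) + 1) * C * ((1 - g) ^ m / (1 - g)) := by gcongr
    _ = _ := by ring

end ShiftDisc

theorem theorem2 (c : ℕ) [NeZero c] (hc : Odd c) (hc3 : 3 ≤ c) :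
    ∃ l₀ : ℕ, 5 ≤ l₀ ∧ ∀ δ : ℝ, 0 < δ → δ < 1 → ∃ ε : ℝ, 0 < ε ∧
      ∀ k N l : ℕ, l₀ ≤ l → l ∣ k → (l : ℝ) ^ (7 + 3 * δ) ≤ (k : ℝ) →
        N ≤ 4 * ShiftDisc.tw (l - 3) 2 →
        (∃ κ : (ShiftDisc.shiftGraph N l).Coloring (Fin 3),
          ∀ X, (κ X : ℕ) = ShiftDisc.shiftColor l X.1) ∧
        ∀ S : Finset ℕ, S ⊆ Finset.Icc 1 N →
          (k : ℝ) * (1 + 1 / (l : ℝ)) ≤ (S.card : ℝ) →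
          ShiftDisc.disc (ShiftDisc.blockSumColor c k l) (S.powersetCard k) ≤
            Real.exp (-ε * (l : ℝ) ^ δ) := by
  obtain ⟨η, hη0, hη1, hη⟩ := ShiftDisc.exists_norm_stdAddChar_add_le c
  refine ⟨⌈15552 / η ^ 2⌉₊ + 5, by omega, fun δ hδ _ => ⟨η / 36, by positivity, ?_⟩⟩
  intro k N l hl hlk hk hN
  have hl5 : 5 ≤ l := by omega
  refine ⟨ShiftDisc.exists_coloring_shiftColor hl5 hN, fun S hS hSk => ?_⟩
  obtain ⟨m, rfl⟩ := hlk
  rw [mul_comm l m] at hk hSk ⊢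
  have hl0 : (0 : ℝ) < l := by exact_mod_cast (by omega : 0 < l)
  have hlη : 15552 / η ^ 2 ≤ (l : ℝ) :=
    (Nat.le_ceil _).trans (by exact_mod_cast (by omega : ⌈15552 / η ^ 2⌉₊ ≤ l))
  have hm : (l : ℝ) ^ (6 + 3 * δ) ≤ m := by
    rw [show 7 + 3 * δ = 6 + 3 * δ + 1 by ring, Real.rpow_add_one hl0.ne', Nat.cast_mul] at hk
    exact le_of_mul_le_mul_right hk hl0
  -- The threshold `k * (1 + 1 / l)` is exactly `m * (l + 1)`, the size at which `m * l` is the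
  -- mode.
  have hSn : m * (l + 1) ≤ S.card := by
    have h : (m * l : ℕ) * (1 + 1 / (l : ℝ)) = (m * (l + 1) : ℕ) := by
      push_cast; field_simp
    rw [h] at hSk
    exact_mod_cast hSk
  obtain ⟨d, hd⟩ := Nat.exists_eq_add_of_le hSn
  have hkn : m * l ≤ m * (l + 1) := Nat.mul_le_mul_left m (by omega)
  refine (ShiftDisc.disc_le_of_norm_sum_le _ _ (by omega) ?_ fun t ht => ?_).trans
    (ShiftDisc.error_le_exp hη0 hη1 hδ (by omega) hlη hm)
  · exact Finset.powersetCard_nonempty.2 (hkn.trans hSn)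
  · rw [Finset.card_powersetCard]
    exact ShiftDisc.norm_sum_powersetCard_le hkn (fun Z hZ hZc =>
      ShiftDisc.norm_sum_stdAddChar_le hc hl5 hN hη0 hη1 hη ht (hZ.trans hS) hZc) d S
      subset_rfl hd
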